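/- Consider the discrete-time linear system $x(t+1)=Ax(t)+Bu(t)$, $y(t)=Cx(t)$ with $A\in\mathbb{R}^{n\times n}$, $B\in\mathbb{R}^{n\times m}$, $C\in\mathbb{R}^{l\times n}$, where $(A,B)$ is controllable and $(A,C)$ is observable. Let $Q\in\mathbb{R}^{l\times l}$ be symmetric with $Q\succeq 0$ and let $R\in\mathbb{R}^{m\times m}$ be symmetric with $R\succ 0$. Assume moreover that $(A,QC)$ is observable (equivalently, that $(A,Q^{1/2}C)$ is observable; this holds automatically if $Q\succ 0$). For $P\in\mathbb{R}^{n\times n}$ write $$\mathcal{R}(P)=A^{\top}PA-A^{\top}PB(R+B^{\top}PB)^{-1}B^{\top}PA+C^{\top}QC,\qquad \mathcal{K}(P)=(R+B^{\top}PB)^{-1}B^{\top}PA .$$ For a horizon $T$ let $P_T=C^{\top}QC$, $P_t=\mathcal{R}(P_{t+1})$ for $0\le t<T$, and $K_t=\mathcal{K}(P_{t+1})$ for $0\le t\le T-1$. Let $$F_u=\begin{bmatrix}A^{n-1}B&\cdots&AB&B\end{bmatrix},\qquad \mathcal{O}=\begin{bmatrix}C\\ CA\\ \vdots\\ CA^{n-1}\end{bmatrix},$$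 let $\mathcal{O}^{\dagger}$ be the Moore--Penrose pseudoinverse of $\mathcal{O}$, and let $\mathbf{S}$ be the strictly lower block triangular Toeplitz matrix with $n\times n$ blocks of size $l\times m$ whose $(i,j)$ block is $CA^{i-j-1}B$ for $i>j$ and $0$ for $i\le j$. Put $H=\begin{bmatrix}F_u-A^n\mathcal{O}^{\dagger}\mathbf{S}&A^n\mathcal{O}^{\dagger}\end{bmatrix}$ and define the time-varying input/output LQR gain $K_{\mathrm{LQR}}^{t}=K_tH$ for $0\le t\le T-1$. Then the algebraic Riccati equation $P=\mathcal{R}(P)$ has a unique symmetric positive definite solution $P^{*}$. With the stationary gains $K^{*}=\mathcal{K}(P^{*})$ and $K_{\mathrm{LQR}}^{*}=K^{*}H$, there are constants $c_1,c_2>0$ and $0<\mu<1$, depending only on $A,B,C,Q,R$, such that for every horizon $T$ and every $1\le t\le T$ $$\bigl\|K_{\mathrm{LQR}}^{T-t}-K_{\mathrm{LQR}}^{*}\bigr\|\le c_1c_2\,\mu^{t},$$ where $\|\cdot\|$ is the spectral norm. -/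

import Mathlib

open scoped Matrix Matrix.Norms.L2Operator

namespace LQR

/-! ### Moore–Penrose pseudoinverse of a real matrix -/

/-- `Y` is the Moore–Penrose pseudoinverse of `X`: the four Penrose equations. -/
structure IsMoorePenrose {p q : Type*} [Fintype p] [Fintype q]
    (X : Matrix p q ℝ) (Y : Matrix q p ℝ) : Prop where
  mul_mul_left : X * Y * X = X
  mul_mul_right : Y * X * Y = Y
  symm_left : (X * Y)ᵀ = X * Y
  symm_right : (Y * X)ᵀ = Y * X

/-- Every real matrix has a Moore–Penrose pseudoinverse. -/
theorem exists_isMoorePenrose {p q : Type*} [Fintype p] [Fintype q]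
    (X : Matrix p q ℝ) : ∃ Y : Matrix q p ℝ, IsMoorePenrose X Y := by
  classical
  have hG : (Xᵀ * X).IsHermitian := by
    simpa using Matrix.isHermitian_conjTranspose_mul_self X
  set d : q → ℝ := hG.eigenvalues with hd
  set U : Matrix q q ℝ := (hG.eigenvectorUnitary : Matrix q q ℝ) with hU
  have hUU : Uᵀ * U = 1 := by
    have := Unitary.coe_star_mul_self hG.eigenvectorUnitary
    simpa [Matrix.star_eq_conjTranspose] using this
  have hGe : Xᵀ * X = U * Matrix.diagonal d * Uᵀ := by
    have := hG.spectral_theorem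
    simpa [Unitary.conjStarAlgAut_apply, Matrix.star_eq_conjTranspose, Function.comp_def] using this
  set G : Matrix q q ℝ := U * Matrix.diagonal (fun i => (d i)⁻¹) * Uᵀ with hGp
  have key : ∀ a b : q → ℝ, (U * Matrix.diagonal a * Uᵀ) * (U * Matrix.diagonal b * Uᵀ)
      = U * Matrix.diagonal (fun i => a i * b i) * Uᵀ := by
    intro a b
    calc _ = U * Matrix.diagonal a * (Uᵀ * U) * Matrix.diagonal b * Uᵀ := by
          simp only [Matrix.mul_assoc]
      _ = _ := by
          rw [hUU, Matrix.mul_one, Matrix.mul_assoc U, Matrix.diagonal_mul_diagonal]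
  have sym : ∀ a : q → ℝ, (U * Matrix.diagonal a * Uᵀ)ᵀ = U * Matrix.diagonal a * Uᵀ := by
    intro a
    simp [Matrix.transpose_mul, Matrix.mul_assoc]
  have hGX : G * (Xᵀ * X) = U * Matrix.diagonal (fun i => (d i)⁻¹ * d i) * Uᵀ := by
    rw [hGe, hGp, key]
  have hXGX : X * (G * (Xᵀ * X)) = X := by
    have h0 : Xᵀ * X * (G * (Xᵀ * X)) = Xᵀ * X := by
      rw [hGX, hGe, key]
      congr 3
      funext i
      by_cases h : d i = 0 <;> simp [h]
    have h1 : (X * (G * (Xᵀ * X)) - X)ᵀ * (X * (G * (Xᵀ * X)) - X) = 0 := by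
      have h2 : Xᵀ * (X * (G * (Xᵀ * X)) - X) = 0 := by
        rw [Matrix.mul_sub, ← Matrix.mul_assoc, h0, sub_self]
      rw [Matrix.transpose_sub, Matrix.transpose_mul, Matrix.sub_mul, Matrix.mul_assoc, h2]
      simp
    have h3 := Matrix.conjTranspose_mul_self_eq_zero.mp
      (show (X * (G * (Xᵀ * X)) - X)ᴴ * (X * (G * (Xᵀ * X)) - X) = 0 by simpa using h1)
    exact sub_eq_zero.mp h3
  refine ⟨G * Xᵀ, ?_, ?_, ?_, ?_⟩
  · simpa only [Matrix.mul_assoc] using hXGX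
  · have : G * (Xᵀ * X) * G = G := by
      rw [hGX, hGp, key]
      congr 3
      funext i
      by_cases h : d i = 0 <;> simp [h]
    calc G * Xᵀ * X * (G * Xᵀ) = (G * (Xᵀ * X) * G) * Xᵀ := by simp only [Matrix.mul_assoc]
      _ = _ := by rw [this]
  · have : Gᵀ = G := sym _
    simp [Matrix.transpose_mul, this, Matrix.mul_assoc]
  · rw [Matrix.mul_assoc, hGX, sym]

/-- The Moore–Penrose pseudoinverse `X†`. -/
noncomputable def pinv {p q : Type*} [Fintype p] [Fintype q] (X : Matrix p q ℝ) :
    Matrix q p ℝ :=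
  Classical.choose (exists_isMoorePenrose X)

theorem pinv_spec {p q : Type*} [Fintype p] [Fintype q] (X : Matrix p q ℝ) :
    IsMoorePenrose X (pinv X) :=
  Classical.choose_spec (exists_isMoorePenrose X)

/-- The four Penrose equations determine the pseudoinverse. -/
theorem IsMoorePenrose.unique {p q : Type*} [Fintype p] [Fintype q] {X : Matrix p q ℝ}
    {Y Z : Matrix q p ℝ} (hY : IsMoorePenrose X Y) (hZ : IsMoorePenrose X Z) : Y = Z := by
  have h1 : X * Y = X * Z := by
    calc X * Y = (X * Y)ᵀ := hY.symm_left.symm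
      _ = (X * Z * (X * Y))ᵀ := by rw [← Matrix.mul_assoc, hZ.mul_mul_left]
      _ = X * Y * (X * Z) := by rw [Matrix.transpose_mul, hY.symm_left, hZ.symm_left]
      _ = X * Z := by rw [← Matrix.mul_assoc, hY.mul_mul_left]
  have h2 : Y * X = Z * X := by
    calc Y * X = (Y * X)ᵀ := hY.symm_right.symm
      _ = (Y * X * (Z * X))ᵀ := by
          rw [Matrix.mul_assoc, ← Matrix.mul_assoc X, hZ.mul_mul_left]
      _ = Z * X * (Y * X) := by rw [Matrix.transpose_mul, hY.symm_right, hZ.symm_right]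
      _ = Z * X := by rw [Matrix.mul_assoc, ← Matrix.mul_assoc X, hY.mul_mul_left]
  calc Y = Y * X * Y := hY.mul_mul_right.symm
    _ = Z * (X * Y) := by rw [h2, Matrix.mul_assoc]
    _ = Z * X * Z := by rw [h1, Matrix.mul_assoc]
    _ = Z := hZ.mul_mul_right

/-! ### The system `x(t+1) = A x(t) + B u(t)`, `y(t) = C x(t)` -/

/-- `F_u = [A^{n-1} B, …, A B, B]`; the first component of a column index is the block index. -/
def ctrbMatrix {n m : ℕ} (A : Matrix (Fin n) (Fin n) ℝ) (B : Matrix (Fin n) (Fin m) ℝ) :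
    Matrix (Fin n) (Fin n × Fin m) ℝ :=
  Matrix.of fun i j => (A ^ (n - 1 - (j.1 : ℕ)) * B) i j.2

/-- The observability matrix, with block rows `C, C A, …, C A^{n-1}`. -/
def obsvMatrix {n l : ℕ} (A : Matrix (Fin n) (Fin n) ℝ) (C : Matrix (Fin l) (Fin n) ℝ) :
    Matrix (Fin n × Fin l) (Fin n) ℝ :=
  Matrix.of fun i j => (C * A ^ (i.1 : ℕ)) i.2 j

/-- `(A, B)` is controllable: `[A^{n-1} B, …, A B, B]` has rank `n`. -/
def IsControllable {n m : ℕ} (A : Matrix (Fin n) (Fin n) ℝ) (B : Matrix (Fin n) (Fin m) ℝ) :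
    Prop :=
  (ctrbMatrix A B).rank = n

/-- `(A, C)` is observable: the observability matrix has rank `n`. -/
def IsObservable {n l : ℕ} (A : Matrix (Fin n) (Fin n) ℝ) (C : Matrix (Fin l) (Fin n) ℝ) :
    Prop :=
  (obsvMatrix A C).rank = n

/-- The impulse response `M(k) = C A^{k-1} B` (used for `k ≥ 1` only). -/
def markov {n m l : ℕ} (A : Matrix (Fin n) (Fin n) ℝ) (B : Matrix (Fin n) (Fin m) ℝ)
    (C : Matrix (Fin l) (Fin n) ℝ) (k : ℕ) : Matrix (Fin l) (Fin m) ℝ :=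
  C * A ^ (k - 1) * B

/-- The block lower triangular Toeplitz matrix with `N` block rows and columns: zero blocks on and
above the diagonal and `M(i - j)` in block position `(i, j)`, `i > j`. The matrix `S_t` for the
horizon `T` has `N = T - t + 1` blocks, so that `S_{T-n+1}` has `N = n` blocks for every `T`. -/
def toeplitzS {n m l : ℕ} (A : Matrix (Fin n) (Fin n) ℝ) (B : Matrix (Fin n) (Fin m) ℝ)
    (C : Matrix (Fin l) (Fin n) ℝ) (N : ℕ) : Matrix (Fin N × Fin l) (Fin N × Fin m) ℝ :=
  Matrix.of fun i j =>
    if j.1 < i.1 then markov A B C ((i.1 : ℕ) - (j.1 : ℕ)) i.2 j.2 else 0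

/-- The matrix `[F_u - A^n O† S_{T-n+1}, A^n O†]`, acting on the stacked past inputs and
outputs `(U_n(t), Y_n(t))`. -/
noncomputable def windowMatrix {n m l : ℕ} (A : Matrix (Fin n) (Fin n) ℝ)
    (B : Matrix (Fin n) (Fin m) ℝ) (C : Matrix (Fin l) (Fin n) ℝ) :
    Matrix (Fin n) ((Fin n × Fin m) ⊕ (Fin n × Fin l)) ℝ :=
  Matrix.fromCols
    (ctrbMatrix A B - A ^ n * pinv (obsvMatrix A C) * toeplitzS A B C n)
    (A ^ n * pinv (obsvMatrix A C))

/-! ### Riccati recursion and gains -/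

/-- The right-hand side of the Riccati equation,
`AᵀPA - AᵀPB (R + BᵀPB)⁻¹ BᵀPA + CᵀQC`. -/
noncomputable def riccatiMap {n m l : ℕ} (A : Matrix (Fin n) (Fin n) ℝ)
    (B : Matrix (Fin n) (Fin m) ℝ) (C : Matrix (Fin l) (Fin n) ℝ)
    (Q : Matrix (Fin l) (Fin l) ℝ) (R : Matrix (Fin m) (Fin m) ℝ)
    (P : Matrix (Fin n) (Fin n) ℝ) : Matrix (Fin n) (Fin n) ℝ :=
  Aᵀ * P * A - Aᵀ * P * B * (R + Bᵀ * P * B)⁻¹ * Bᵀ * P * A + Cᵀ * Q * C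

/-- The state feedback gain `(R + BᵀPB)⁻¹ BᵀPA` belonging to `P`. -/
noncomputable def feedbackGain {n m : ℕ} (A : Matrix (Fin n) (Fin n) ℝ)
    (B : Matrix (Fin n) (Fin m) ℝ) (R : Matrix (Fin m) (Fin m) ℝ)
    (P : Matrix (Fin n) (Fin n) ℝ) : Matrix (Fin m) (Fin n) ℝ :=
  (R + Bᵀ * P * B)⁻¹ * Bᵀ * P * A

/-- The solution `P_t` (`0 ≤ t ≤ T`) of the backward Riccati recursion with `P_T = CᵀQC`. -/
noncomputable def riccatiP {n m l : ℕ} (A : Matrix (Fin n) (Fin n) ℝ)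
    (B : Matrix (Fin n) (Fin m) ℝ) (C : Matrix (Fin l) (Fin n) ℝ)
    (Q : Matrix (Fin l) (Fin l) ℝ) (R : Matrix (Fin m) (Fin m) ℝ) (T t : ℕ) :
    Matrix (Fin n) (Fin n) ℝ :=
  (riccatiMap A B C Q R)^[T - t] (Cᵀ * Q * C)

theorem riccatiP_terminal {n m l : ℕ} (A : Matrix (Fin n) (Fin n) ℝ)
    (B : Matrix (Fin n) (Fin m) ℝ) (C : Matrix (Fin l) (Fin n) ℝ)
    (Q : Matrix (Fin l) (Fin l) ℝ) (R : Matrix (Fin m) (Fin m) ℝ) (T : ℕ) :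
    riccatiP A B C Q R T T = Cᵀ * Q * C := by
  simp [riccatiP]

theorem riccatiP_step {n m l : ℕ} (A : Matrix (Fin n) (Fin n) ℝ)
    (B : Matrix (Fin n) (Fin m) ℝ) (C : Matrix (Fin l) (Fin n) ℝ)
    (Q : Matrix (Fin l) (Fin l) ℝ) (R : Matrix (Fin m) (Fin m) ℝ) {T t : ℕ} (h : t < T) :
    riccatiP A B C Q R T t = riccatiMap A B C Q R (riccatiP A B C Q R T (t + 1)) := by
  have : T - t = (T - (t + 1)) + 1 := by omega
  rw [riccatiP, this, Function.iterate_succ_apply', riccatiP]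

/-- `P` is a positive definite solution of the discrete-time algebraic Riccati equation. -/
def IsPosDefDARESolution {n m l : ℕ} (A : Matrix (Fin n) (Fin n) ℝ)
    (B : Matrix (Fin n) (Fin m) ℝ) (C : Matrix (Fin l) (Fin n) ℝ)
    (Q : Matrix (Fin l) (Fin l) ℝ) (R : Matrix (Fin m) (Fin m) ℝ)
    (P : Matrix (Fin n) (Fin n) ℝ) : Prop :=
  P.PosDef ∧ P = riccatiMap A B C Q R P

/-- The gain `K_LQR^t = K_t [F_u - A^n O† S_{T-n+1}, A^n O†]` for the horizon `T`, with
`K_t = (R + BᵀP_{t+1}B)⁻¹ BᵀP_{t+1}A` (`0 ≤ t ≤ T - 1`). -/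
noncomputable def gainLQR {n m l : ℕ} (A : Matrix (Fin n) (Fin n) ℝ)
    (B : Matrix (Fin n) (Fin m) ℝ) (C : Matrix (Fin l) (Fin n) ℝ)
    (Q : Matrix (Fin l) (Fin l) ℝ) (R : Matrix (Fin m) (Fin m) ℝ) (T t : ℕ) :
    Matrix (Fin m) ((Fin n × Fin m) ⊕ (Fin n × Fin l)) ℝ :=
  feedbackGain A B R (riccatiP A B C Q R T (t + 1)) * windowMatrix A B C

/-- The stationary gain `K_LQR^* = K^* [F_u - A^n O† S_{T-n+1}, A^n O†]`, with
`K^* = (R + BᵀP^*B)⁻¹ BᵀP^*A`, belonging to `P^* = Pstar`. -/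
noncomputable def gainLQRStar {n m l : ℕ} (A : Matrix (Fin n) (Fin n) ℝ)
    (B : Matrix (Fin n) (Fin m) ℝ) (C : Matrix (Fin l) (Fin n) ℝ)
    (R : Matrix (Fin m) (Fin m) ℝ) (Pstar : Matrix (Fin n) (Fin n) ℝ) :
    Matrix (Fin m) ((Fin n × Fin m) ⊕ (Fin n × Fin l)) ℝ :=
  feedbackGain A B R Pstar * windowMatrix A B C

end LQR

namespace LQR

open Filter Topology
open scoped MatrixOrder

/-! ### The Loewner order on real matrices -/

section Loewner

variable {p q : Type*} [Fintype p] [Fintype q]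

/-! Let `X_k` be the Riccati iterates started at `CᵀQC`, and `F_X = A - B K(X)`. The matrix `X_k` is
an optimal finite-horizon cost, so it increases with `k`; controllability bounds it by the cost of
steering to `0` in `n` steps. Hence `X_k` converges, and the limit `P` is a fixed point.
Observability of `(A, QC)` makes `X_n`, and so `P ≥ X_n`, positive definite, and makes `F_P` stable
(`exists_norm_closedLoop_pow_le`).

Everything else rests on the exact identity `ℛ(Y) - ℛ(X) = F_Yᵀ (Y - X) F_X`
(`riccatiMap_sub_riccatiMap`). Iterated between two positive definite solutions, it sends their
difference to `0`, which is uniqueness. Iterated between `P` and `X_{n+k}`, it gives `(F_Pᵏ)ᵀ (P -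
X_n) Φ_k`, with `Φ_k` a product of time-varying closed loops. The left factor decays; `Φ_k` is
merely bounded, because `Φ_kᵀ X_n Φ_k ≤ X_{n+k} ≤ P` with `X_n` positive definite. The difference of
gains is a fixed matrix times such an expression. -/

theorem dotProduct_self_eq_norm_sq (x : p → ℝ) : x ⬝ᵥ x = ‖WithLp.toLp 2 x‖ ^ 2 := by
  rw [EuclideanSpace.norm_sq_eq]
  simp [dotProduct, sq]

theorem dotProduct_mulVec_mono {M N : Matrix p p ℝ} (h : M ≤ N) (x : p → ℝ) :
    x ⬝ᵥ M *ᵥ x ≤ x ⬝ᵥ N *ᵥ x := by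
  have := (Matrix.le_iff.mp h).dotProduct_mulVec_nonneg x
  simpa [Matrix.sub_mulVec, dotProduct_sub] using this

theorem le_of_dotProduct_mulVec_le {M N : Matrix p p ℝ} (hM : Mᵀ = M) (hN : Nᵀ = N)
    (h : ∀ x, x ⬝ᵥ M *ᵥ x ≤ x ⬝ᵥ N *ᵥ x) : M ≤ N := by
  refine Matrix.le_iff.mpr (.of_dotProduct_mulVec_nonneg ?_ fun x => ?_)
  · simp [Matrix.IsHermitian, hM, hN]
  · simpa [Matrix.sub_mulVec, dotProduct_sub] using h x

theorem transpose_mul_mul_mono {M N : Matrix p p ℝ} (h : M ≤ N) (Z : Matrix p q ℝ) :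
    Zᵀ * M * Z ≤ Zᵀ * N * Z := by
  have := (Matrix.le_iff.mp h).conjTranspose_mul_mul_same Z
  rw [Matrix.le_iff]
  simpa [Matrix.mul_sub, Matrix.sub_mul] using this

theorem transpose_mul_mul_nonneg {M : Matrix p p ℝ} (h : 0 ≤ M) (Z : Matrix p q ℝ) :
    0 ≤ Zᵀ * M * Z := by
  simpa using transpose_mul_mul_mono h Z

theorem transpose_eq_of_nonneg {p : Type*} {M : Matrix p p ℝ} (h : 0 ≤ M) : Mᵀ = M := by
  simpa [Matrix.conjTranspose_eq_transpose_of_trivial] using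
    (Matrix.nonneg_iff_posSemidef.mp h).isHermitian.eq

theorem posDef_of_le {p : Type*} {M N : Matrix p p ℝ} (hM : M.PosDef) (h : M ≤ N) : N.PosDef := by
  simpa using hM.add_posSemidef (Matrix.le_iff.mp h)

/-- A positive semidefinite matrix whose quadratic form vanishes only at `0` is positive
definite. -/
theorem posDef_of_nonneg {M : Matrix p p ℝ} (h : 0 ≤ M)
    (h0 : ∀ x, x ⬝ᵥ M *ᵥ x = 0 → x = 0) : M.PosDef := by
  refine Matrix.PosDef.of_dotProduct_mulVec_pos (Matrix.nonneg_iff_posSemidef.mp h).isHermitian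
    fun x hx => ?_
  refine lt_of_le_of_ne ((Matrix.nonneg_iff_posSemidef.mp h).dotProduct_mulVec_nonneg x)
    fun he => hx (h0 x ?_)
  simpa using he.symm

theorem dotProduct_transpose_mul_mul (M : Matrix p p ℝ) (Z : Matrix p q ℝ) (x : q → ℝ) :
    x ⬝ᵥ (Zᵀ * M * Z) *ᵥ x = (Z *ᵥ x) ⬝ᵥ M *ᵥ (Z *ᵥ x) := by
  rw [← Matrix.mulVec_mulVec, ← Matrix.mulVec_mulVec, Matrix.dotProduct_mulVec,
    Matrix.vecMul_transpose]

theorem exists_pos_smul_one_le [DecidableEq p] {M : Matrix p p ℝ} (hM : M.PosDef) :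
    ∃ ε : ℝ, 0 < ε ∧ ε • (1 : Matrix p p ℝ) ≤ M := by
  -- The spectral criterion needs a nontrivial algebra; over an empty index type any `ε` works.
  rcases subsingleton_or_nontrivial (Matrix p p ℝ) with h | h
  · exact ⟨1, one_pos, (Subsingleton.elim _ _).le⟩
  · have hs := hM.isStrictlyPositive
    obtain ⟨r, hr, hle⟩ := (CFC.exists_pos_algebraMap_le_iff hM.isHermitian).2
      fun x hx => hs.spectrum_pos hx
    exact ⟨r, hr, by simpa [Algebra.algebraMap_eq_smul_one] using hle⟩

/-- Cauchy–Schwarz. The `+ 1` keeps the factor strictly positive, even for `M = 0`. -/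
theorem le_smul_one [DecidableEq p] {M : Matrix p p ℝ} (hM : Mᵀ = M) :
    M ≤ (‖M‖ + 1) • (1 : Matrix p p ℝ) := by
  refine le_of_dotProduct_mulVec_le hM (by simp) fun x => ?_
  rw [Matrix.smul_mulVec, Matrix.one_mulVec, dotProduct_smul, dotProduct_self_eq_norm_sq,
    smul_eq_mul]
  have h1 : x ⬝ᵥ M *ᵥ x ≤ ‖WithLp.toLp 2 x‖ * ‖WithLp.toLp 2 (M *ᵥ x)‖ := by
    have := real_inner_le_norm (WithLp.toLp 2 x) (WithLp.toLp 2 (M *ᵥ x))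
    rwa [EuclideanSpace.inner_toLp_toLp, dotProduct_comm] at this
  have h2 : ‖WithLp.toLp 2 (M *ᵥ x)‖ ≤ ‖M‖ * ‖WithLp.toLp 2 x‖ :=
    Matrix.l2_opNorm_mulVec M (WithLp.toLp 2 x)
  nlinarith [norm_nonneg (WithLp.toLp 2 x), sq_nonneg ‖WithLp.toLp 2 x‖]

theorem norm_le_of_transpose_mul_self_le [DecidableEq q] {M : Matrix p q ℝ} {c : ℝ} (hc : 0 ≤ c)
    (h : Mᵀ * M ≤ c ^ 2 • (1 : Matrix q q ℝ)) : ‖M‖ ≤ c := by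
  rw [Matrix.l2_opNorm_def]
  refine ContinuousLinearMap.opNorm_le_bound _ hc fun x => ?_
  have h1 := dotProduct_mulVec_mono h x.ofLp
  rw [← Matrix.mulVec_mulVec, Matrix.dotProduct_mulVec, Matrix.vecMul_transpose,
    Matrix.smul_mulVec, Matrix.one_mulVec, dotProduct_smul, dotProduct_self_eq_norm_sq,
    dotProduct_self_eq_norm_sq, smul_eq_mul, ← mul_pow] at h1
  exact abs_le_of_sq_le_sq' h1 (by positivity) |>.2

/-- A quadratic form bound `ΦᵀYΦ ≤ r² P` with `Y` positive definite bounds the norm of `Φ`. -/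
theorem exists_norm_le_of_transpose_mul_mul_le [DecidableEq p] {Y P : Matrix p p ℝ}
    (hY : Y.PosDef) (hP : Pᵀ = P) :
    ∃ c : ℝ, 0 < c ∧ ∀ (Φ : Matrix p p ℝ) (r : ℝ), 0 ≤ r → Φᵀ * Y * Φ ≤ r ^ 2 • P →
      ‖Φ‖ ≤ c * r := by
  obtain ⟨ε, hε, hεY⟩ := exists_pos_smul_one_le hY
  have hs : 0 < (‖P‖ + 1) / ε := by positivity
  -- From `ε ΦᵀΦ ≤ ΦᵀYΦ ≤ r² P ≤ r² (‖P‖ + 1)`.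
  refine ⟨√((‖P‖ + 1) / ε), Real.sqrt_pos.mpr hs, fun Φ r hr h => ?_⟩
  refine norm_le_of_transpose_mul_self_le (by positivity) ?_
  have h1 : Φᵀ * (ε • (1 : Matrix p p ℝ)) * Φ ≤ r ^ 2 • ((‖P‖ + 1) • (1 : Matrix p p ℝ)) :=
    (transpose_mul_mul_mono hεY Φ).trans
      (h.trans (smul_le_smul_of_nonneg_left (le_smul_one hP) (by positivity)))
  have h2 := smul_le_smul_of_nonneg_left h1 (inv_nonneg.mpr hε.le)
  rw [mul_pow, Real.sq_sqrt hs.le]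
  convert h2 using 1
  · simp [smul_smul, hε.ne']
  · rw [smul_smul, smul_smul]
    congr 1
    field_simp

theorem transpose_pow_mul_mul_pow_le [DecidableEq p] {F S : Matrix p p ℝ} {ρ : ℝ} (hρ : 0 ≤ ρ)
    (h : Fᵀ * S * F ≤ ρ • S) (k : ℕ) : (F ^ k)ᵀ * S * F ^ k ≤ ρ ^ k • S := by
  induction k with
  | zero => simp
  | succ k ih =>
    calc (F ^ (k + 1))ᵀ * S * F ^ (k + 1) = Fᵀ * ((F ^ k)ᵀ * S * F ^ k) * F := by
          simp only [pow_succ, Matrix.transpose_mul, Matrix.mul_assoc]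
      _ ≤ Fᵀ * (ρ ^ k • S) * F := transpose_mul_mul_mono ih F
      _ = ρ ^ k • (Fᵀ * S * F) := by simp
      _ ≤ ρ ^ k • (ρ • S) := smul_le_smul_of_nonneg_left h (by positivity)
      _ = ρ ^ (k + 1) • S := by rw [smul_smul, pow_succ]

/-- Lyapunov's criterion: if `S` and `S - FᵀSF` are positive definite, the powers of `F` decay
exponentially. -/
theorem exists_norm_pow_le_of_lyapunov [DecidableEq p] {F S : Matrix p p ℝ} (hS : S.PosDef)
    (hF : (S - Fᵀ * S * F).PosDef) :
    ∃ c μ : ℝ, 0 < c ∧ 0 < μ ∧ μ < 1 ∧ ∀ k : ℕ, ‖F ^ k‖ ≤ c * μ ^ k := by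
  have hSt : Sᵀ = S := transpose_eq_of_nonneg hS.posSemidef.nonneg
  obtain ⟨ε, hε, hεD⟩ := exists_pos_smul_one_le hF
  -- Taking `s > ε` strictly puts the contraction ratio `1 - ε / s` of the form `S` inside `(0, 1)`.
  obtain ⟨s, hs, hεs, hSs⟩ : ∃ s : ℝ, 0 < s ∧ ε < s ∧ S ≤ s • (1 : Matrix p p ℝ) := by
    refine ⟨‖S‖ + 1 + ε, by positivity, by linarith [norm_nonneg S], ?_⟩
    refine (le_smul_one hSt).trans ?_
    rw [add_smul (‖S‖ + 1)]
    exact le_add_of_nonneg_right (smul_nonneg hε.le Matrix.PosSemidef.one.nonneg)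
  have hlt : 0 < 1 - ε / s := by rw [sub_pos, div_lt_one hs]; exact hεs
  have hstep : Fᵀ * S * F ≤ (1 - ε / s) • S := by
    have h1 : (ε / s) • S ≤ S - Fᵀ * S * F := by
      refine le_trans ?_ hεD
      have := smul_le_smul_of_nonneg_left hSs (div_nonneg hε.le hs.le)
      rwa [smul_smul, div_mul_cancel₀ _ hs.ne'] at this
    rw [sub_smul, one_smul]
    exact le_sub_comm.mp h1
  obtain ⟨c, hc, hcΦ⟩ := exists_norm_le_of_transpose_mul_mul_le hS hSt
  refine ⟨c, √(1 - ε / s), hc, Real.sqrt_pos.mpr hlt, ?_, fun k => ?_⟩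
  · rw [Real.sqrt_lt' one_pos]
    have : 0 < ε / s := by positivity
    linarith
  · refine hcΦ _ _ (by positivity) ?_
    rw [← pow_mul, mul_comm, pow_mul, Real.sq_sqrt hlt.le]
    exact transpose_pow_mul_mul_pow_le hlt.le hstep k

/-- A monotone sequence of symmetric matrices that is bounded above converges to an upper
bound. -/
theorem exists_tendsto_of_monotone [DecidableEq p] {X : ℕ → Matrix p p ℝ} {Y : Matrix p p ℝ}
    (hsymm : ∀ k, (X k)ᵀ = X k) (hmono : Monotone X) (hbdd : ∀ k, X k ≤ Y) :
    ∃ P : Matrix p p ℝ, Tendsto X atTop (𝓝 P) ∧ ∀ k, X k ≤ P := by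
  have hq : ∀ x : p → ℝ, ∃ a, Tendsto (fun k => x ⬝ᵥ X k *ᵥ x) atTop (𝓝 a) := fun x =>
    ⟨_, tendsto_atTop_ciSup (fun _ _ h => dotProduct_mulVec_mono (hmono h) x)
      ⟨x ⬝ᵥ Y *ᵥ x, by rintro _ ⟨k, rfl⟩; exact dotProduct_mulVec_mono (hbdd k) x⟩⟩
  -- Polarization: quadratic forms at `e_i + e_j`, `e_i`, `e_j` determine the entry of a symmetric
  -- matrix.
  have hentry : ∀ i j, ∃ a, Tendsto (fun k => X k i j) atTop (𝓝 a) := by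
    intro i j
    obtain ⟨a, ha⟩ := hq (Pi.single i 1 + Pi.single j 1)
    obtain ⟨b, hb⟩ := hq (Pi.single i 1)
    obtain ⟨c, hc⟩ := hq (Pi.single j 1)
    refine ⟨(a - b - c) / 2, (((ha.sub hb).sub hc).div_const 2).congr fun k => ?_⟩
    have : X k j i = X k i j := congrFun (congrFun (hsymm k) i) j
    simp [Matrix.mulVec_add, add_dotProduct, this]
    ring
  choose P hP using hentry
  have hlim : Tendsto X atTop (𝓝 (Matrix.of P)) :=
    tendsto_pi_nhds.mpr fun i => tendsto_pi_nhds.mpr fun j => hP i j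
  refine ⟨Matrix.of P, hlim, fun k => ?_⟩
  have hPt : (Matrix.of P)ᵀ = Matrix.of P :=
    tendsto_nhds_unique
      (((continuous_id.matrix_transpose.tendsto (Matrix.of P)).comp hlim).congr fun k => hsymm k)
      hlim
  refine le_of_dotProduct_mulVec_le (hsymm k) hPt fun x => ?_
  have hc : Continuous fun M : Matrix p p ℝ => x ⬝ᵥ M *ᵥ x :=
    continuous_const.dotProduct (continuous_id.matrix_mulVec continuous_const)
  exact ge_of_tendsto ((hc.tendsto _).comp hlim)
    (eventually_atTop.mpr ⟨k, fun j hj => dotProduct_mulVec_mono (hmono hj) x⟩)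

end Loewner

/-! ### Algebra of the Riccati map -/

section Riccati

variable {n m l : ℕ} {A : Matrix (Fin n) (Fin n) ℝ} {B : Matrix (Fin n) (Fin m) ℝ}
  {C : Matrix (Fin l) (Fin n) ℝ} {Q : Matrix (Fin l) (Fin l) ℝ} {R : Matrix (Fin m) (Fin m) ℝ}
  {X Y P : Matrix (Fin n) (Fin n) ℝ}

/-- The closed-loop matrix `A - B K(X)`. -/
noncomputable def closedLoop (A : Matrix (Fin n) (Fin n) ℝ) (B : Matrix (Fin n) (Fin m) ℝ)
    (R : Matrix (Fin m) (Fin m) ℝ) (X : Matrix (Fin n) (Fin n) ℝ) : Matrix (Fin n) (Fin n) ℝ :=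
  A - B * feedbackGain A B R X

theorem posDef_add_transpose_mul_mul (hR : R.PosDef) (hX : 0 ≤ X) : (R + Bᵀ * X * B).PosDef :=
  hR.add_posSemidef (Matrix.nonneg_iff_posSemidef.mp (transpose_mul_mul_nonneg hX B))

/-- The normal equation `(R + BᵀXB) K = BᵀXA`, free of inverses and arranged as a rewrite rule;
equivalently `BᵀX F_X = R K`. -/
theorem transpose_mul_mul_feedbackGain (hR : R.PosDef) (hX : 0 ≤ X) :
    Bᵀ * X * B * feedbackGain A B R X = Bᵀ * X * A - R * feedbackGain A B R X := by
  have hM := posDef_add_transpose_mul_mul (B := B) hR hX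
  have : (R + Bᵀ * X * B) * feedbackGain A B R X = Bᵀ * X * A := by
    simp only [feedbackGain, Matrix.mul_assoc _ _ A, Matrix.mul_assoc _ Bᵀ]
    exact Matrix.mul_nonsing_inv_cancel_left _ _ ((Matrix.isUnit_iff_isUnit_det _).mp hM.isUnit)
  rw [Matrix.add_mul] at this
  rw [← this, add_sub_cancel_left]

theorem feedbackGain_transpose_mul_mul (hR : R.PosDef) (hX : 0 ≤ X) :
    (feedbackGain A B R X)ᵀ * (Bᵀ * X * B) = Aᵀ * X * B - (feedbackGain A B R X)ᵀ * R := by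
  have h := congrArg Matrix.transpose (transpose_mul_mul_feedbackGain (A := A) (B := B) hR hX)
  simpa [Matrix.transpose_mul, transpose_eq_of_nonneg hX,
    transpose_eq_of_nonneg hR.posSemidef.nonneg, Matrix.mul_assoc] using h

/-- Both sides equal `Kᵀ (R + BᵀXB) K`. -/
theorem feedbackGain_transpose_mul_comm (hR : R.PosDef) (hX : 0 ≤ X) :
    (feedbackGain A B R X)ᵀ * (Bᵀ * X * A) = Aᵀ * X * B * feedbackGain A B R X := by
  have h1 := transpose_mul_mul_feedbackGain (A := A) (B := B) hR hX
  have h2 := congrArg (· * feedbackGain A B R X)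
    (feedbackGain_transpose_mul_mul (A := A) (B := B) hR hX)
  simp only [Matrix.mul_assoc, Matrix.sub_mul] at h1 h2 ⊢
  rwa [h1, Matrix.mul_sub, sub_left_inj] at h2

theorem riccatiMap_eq : riccatiMap A B C Q R X =
    Aᵀ * X * A - Aᵀ * X * B * feedbackGain A B R X + Cᵀ * Q * C := by
  simp only [riccatiMap, feedbackGain, Matrix.mul_assoc]

/-- Completion of squares for the Bellman operator. -/
theorem bellman_eq {p : Type*} [Fintype p] (hR : R.PosDef) (hX : 0 ≤ X)
    (Z : Matrix (Fin n) p ℝ) (U : Matrix (Fin m) p ℝ) :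
    (A * Z + B * U)ᵀ * X * (A * Z + B * U) + Uᵀ * R * U + Zᵀ * (Cᵀ * Q * C) * Z =
      Zᵀ * riccatiMap A B C Q R X * Z +
        (U + feedbackGain A B R X * Z)ᵀ * (R + Bᵀ * X * B) * (U + feedbackGain A B R X * Z) := by
  have h1 := transpose_mul_mul_feedbackGain (A := A) (B := B) hR hX
  have h2 := feedbackGain_transpose_mul_mul (A := A) (B := B) hR hX
  have h3 := feedbackGain_transpose_mul_comm (A := A) (B := B) hR hX
  rw [riccatiMap_eq]
  set K := feedbackGain A B R X
  -- The trailing factor `T` lets the rules fire inside right-associated products.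
  have e1 : ∀ T : Matrix (Fin n) p ℝ, Bᵀ * (X * (B * (K * T))) =
      Bᵀ * (X * (A * T)) - R * (K * T) := fun T => by
    simpa only [Matrix.mul_assoc, Matrix.sub_mul] using congrArg (· * T) h1
  have e2 : ∀ T : Matrix (Fin m) p ℝ, Kᵀ * (Bᵀ * (X * (B * T))) =
      Aᵀ * (X * (B * T)) - Kᵀ * (R * T) := fun T => by
    simpa only [Matrix.mul_assoc, Matrix.sub_mul] using congrArg (· * T) h2
  have e3 : ∀ T : Matrix (Fin n) p ℝ, Kᵀ * (Bᵀ * (X * (A * T))) = Aᵀ * (X * (B * (K * T))) :=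
    fun T => by simpa only [Matrix.mul_assoc] using congrArg (· * T) h3
  simp only [Matrix.transpose_add, Matrix.transpose_mul, Matrix.mul_add, Matrix.add_mul,
    Matrix.mul_sub, Matrix.sub_mul, Matrix.mul_assoc, e2, e1, e3]
  abel

/-- With `K`, `L` the gains of `X`, `Y`, one has `F_YᵀY F_X = ℛ(Y) - CᵀQC - LᵀRK` and `F_YᵀX F_X =
ℛ(X) - CᵀQC - LᵀRK`. Mixing the two closed loops leaves no quadratic remainder. -/
theorem riccatiMap_sub_riccatiMap (hR : R.PosDef) (hX : 0 ≤ X) (hY : 0 ≤ Y) :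
    riccatiMap A B C Q R Y - riccatiMap A B C Q R X =
      (closedLoop A B R Y)ᵀ * (Y - X) * closedLoop A B R X := by
  have h1 := transpose_mul_mul_feedbackGain (A := A) (B := B) hR hX
  have h2 := feedbackGain_transpose_mul_mul (A := A) (B := B) hR hY
  have h3 := feedbackGain_transpose_mul_comm (A := A) (B := B) hR hY
  rw [riccatiMap_eq, riccatiMap_eq, closedLoop, closedLoop]
  set K := feedbackGain A B R X
  set L := feedbackGain A B R Y
  have e1 : Bᵀ * (X * (B * K)) = Bᵀ * (X * A) - R * K := by
    simpa only [Matrix.mul_assoc] using h1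
  have e2 : ∀ T : Matrix (Fin m) (Fin n) ℝ, Lᵀ * (Bᵀ * (Y * (B * T))) =
      Aᵀ * (Y * (B * T)) - Lᵀ * (R * T) := fun T => by
    simpa only [Matrix.mul_assoc, Matrix.sub_mul] using congrArg (· * T) h2
  have e3 : Lᵀ * (Bᵀ * (Y * A)) = Aᵀ * (Y * (B * L)) := by
    simpa only [Matrix.mul_assoc] using h3
  simp only [Matrix.transpose_sub, Matrix.transpose_mul, Matrix.mul_sub, Matrix.sub_mul,
    Matrix.mul_assoc, e2, e1, e3]
  abel

/-- Multiply by `R + BᵀYB` and use both normal equations. Only the inverse at `Y` survives. -/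
theorem feedbackGain_sub_feedbackGain (hR : R.PosDef) (hX : 0 ≤ X) (hY : 0 ≤ Y) :
    feedbackGain A B R Y - feedbackGain A B R X =
      (R + Bᵀ * Y * B)⁻¹ * Bᵀ * ((Y - X) * closedLoop A B R X) := by
  have hM := (Matrix.isUnit_iff_isUnit_det _).mp
    (posDef_add_transpose_mul_mul (B := B) hR hY).isUnit
  have h1 := transpose_mul_mul_feedbackGain (A := A) (B := B) hR hX
  have h2 := transpose_mul_mul_feedbackGain (A := A) (B := B) hR hY
  have key : (R + Bᵀ * Y * B) * (feedbackGain A B R Y - feedbackGain A B R X) =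
      Bᵀ * ((Y - X) * closedLoop A B R X) := by
    rw [closedLoop]
    set K := feedbackGain A B R X
    set L := feedbackGain A B R Y
    simp only [Matrix.mul_assoc] at h1 h2
    simp only [Matrix.mul_sub, Matrix.add_mul, Matrix.sub_mul, Matrix.mul_assoc, h1, h2]
    abel
  rw [Matrix.mul_assoc, ← key, Matrix.nonsing_inv_mul_cancel_left _ _ hM]

theorem riccatiMap_eq_closedLoop (hR : R.PosDef) (hX : 0 ≤ X) :
    riccatiMap A B C Q R X = (closedLoop A B R X)ᵀ * X * closedLoop A B R X +
      ((feedbackGain A B R X)ᵀ * R * feedbackGain A B R X + Cᵀ * Q * C) := by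
  have := bellman_eq (A := A) (B := B) (C := C) (Q := Q) hR hX 1 (-feedbackGain A B R X)
  simp only [Matrix.mul_one, Matrix.mul_neg, ← sub_eq_add_neg, Matrix.transpose_neg,
    Matrix.neg_mul, neg_neg, Matrix.one_mul, Matrix.transpose_one, neg_add_cancel,
    Matrix.mul_zero, add_zero] at this
  rw [← this, closedLoop, add_assoc]

theorem transpose_mul_riccatiMap_mul_le {p : Type*} [Fintype p] (hR : R.PosDef) (hX : 0 ≤ X)
    (Z : Matrix (Fin n) p ℝ) (U : Matrix (Fin m) p ℝ) :
    Zᵀ * riccatiMap A B C Q R X * Z ≤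
      (A * Z + B * U)ᵀ * X * (A * Z + B * U) + (Uᵀ * R * U + Zᵀ * (Cᵀ * Q * C) * Z) := by
  rw [← add_assoc, bellman_eq hR hX]
  exact le_add_of_nonneg_right (transpose_mul_mul_nonneg
    (posDef_add_transpose_mul_mul hR hX).posSemidef.nonneg _)

/-- The gain of `Y` is suboptimal for `X`, and its cost with terminal weight `X` is at most that
with `Y`. -/
theorem riccatiMap_mono (hR : R.PosDef) (hX : 0 ≤ X) (hXY : X ≤ Y) :
    riccatiMap A B C Q R X ≤ riccatiMap A B C Q R Y := by
  have h := transpose_mul_riccatiMap_mul_le (A := A) (B := B) (C := C) (Q := Q) hR hX 1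
    (-feedbackGain A B R Y)
  rw [riccatiMap_eq_closedLoop hR (hX.trans hXY)]
  simp only [Matrix.mul_one, Matrix.mul_neg, ← sub_eq_add_neg, Matrix.transpose_neg,
    Matrix.neg_mul, neg_neg, Matrix.one_mul, Matrix.transpose_one] at h
  exact h.trans (add_le_add_left (transpose_mul_mul_mono hXY _) _)

theorem stageCost_nonneg (hQ : Q.PosSemidef) (hR : R.PosDef) {p : Type*} [Fintype p]
    (K : Matrix (Fin m) p ℝ) (C : Matrix (Fin l) p ℝ) : 0 ≤ Kᵀ * R * K + Cᵀ * Q * C :=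
  add_nonneg (transpose_mul_mul_nonneg hR.posSemidef.nonneg K)
    (transpose_mul_mul_nonneg hQ.nonneg C)

/-- The stage cost `KᵀRK + CᵀQC` vanishes at `x` only if `Kx = 0` and `QCx = 0`. -/
theorem mulVec_eq_zero_of_stageCost_eq_zero (hQ : Q.PosSemidef) (hR : R.PosDef) {p : Type*}
    [Fintype p] {K : Matrix (Fin m) p ℝ} {C : Matrix (Fin l) p ℝ} {x : p → ℝ}
    (h : x ⬝ᵥ (Kᵀ * R * K + Cᵀ * Q * C) *ᵥ x = 0) : K *ᵥ x = 0 ∧ (Q * C) *ᵥ x = 0 := by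
  rw [Matrix.add_mulVec, dotProduct_add, dotProduct_transpose_mul_mul,
    dotProduct_transpose_mul_mul] at h
  have h1 := hR.posSemidef.dotProduct_mulVec_nonneg (K *ᵥ x)
  have h2 := hQ.dotProduct_mulVec_nonneg (C *ᵥ x)
  simp only [star_trivial] at h1 h2
  constructor
  · by_contra hx
    have := hR.dotProduct_mulVec_pos hx
    simp only [star_trivial] at this
    linarith
  · rw [← Matrix.mulVec_mulVec]
    refine (hQ.dotProduct_mulVec_zero_iff _).mp ?_
    simp only [star_trivial]
    linarith

theorem closedLoop_mul_mul_le_riccatiMap (hQ : Q.PosSemidef) (hR : R.PosDef) (hX : 0 ≤ X) :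
    (closedLoop A B R X)ᵀ * X * closedLoop A B R X ≤ riccatiMap A B C Q R X := by
  rw [riccatiMap_eq_closedLoop hR hX]
  exact le_add_of_nonneg_right (stageCost_nonneg hQ hR _ _)

theorem le_riccatiMap (hR : R.PosDef) (hX : 0 ≤ X) :
    Cᵀ * Q * C ≤ riccatiMap A B C Q R X := by
  rw [riccatiMap_eq_closedLoop hR hX, ← add_assoc]
  exact le_add_of_nonneg_left (add_nonneg (transpose_mul_mul_nonneg hX _)
    (transpose_mul_mul_nonneg hR.posSemidef.nonneg _))

theorem continuousAt_inv_add_transpose_mul_mul (hR : R.PosDef) (hX : 0 ≤ X) :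
    ContinuousAt (fun X : Matrix (Fin n) (Fin n) ℝ => (R + Bᵀ * X * B)⁻¹) X := by
  have hdet : (R + Bᵀ * X * B).det ≠ 0 := (posDef_add_transpose_mul_mul hR hX).det_pos.ne'
  have hM : Continuous fun X : Matrix (Fin n) (Fin n) ℝ => R + Bᵀ * X * B := by fun_prop
  have hinv : ContinuousAt Inv.inv (R + Bᵀ * X * B) := by
    refine continuousAt_matrix_inv _ ?_
    rw [Ring.inverse_eq_inv']
    exact continuousAt_inv₀ hdet
  exact hinv.tendsto.comp (hM.tendsto X)

theorem continuousAt_riccatiMap (hR : R.PosDef) (hX : 0 ≤ X) :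
    ContinuousAt (riccatiMap A B C Q R) X := by
  have hc : Continuous fun T : Matrix (Fin n) (Fin n) ℝ × Matrix (Fin m) (Fin m) ℝ =>
      Aᵀ * T.1 * A - Aᵀ * T.1 * B * T.2 * Bᵀ * T.1 * A + Cᵀ * Q * C := by fun_prop
  have hp := tendsto_id.prodMk_nhds
    (continuousAt_inv_add_transpose_mul_mul (B := B) hR hX).tendsto
  have h := (hc.tendsto (X, (R + Bᵀ * X * B)⁻¹)).comp hp
  unfold ContinuousAt riccatiMap
  exact h

end Riccati

/-! ### Controllability and observability -/

section Structural

variable {n m l : ℕ} {A : Matrix (Fin n) (Fin n) ℝ} {B : Matrix (Fin n) (Fin m) ℝ}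
  {C : Matrix (Fin l) (Fin n) ℝ}

theorem IsControllable.exists_ctrbMatrix_mul_eq_one (h : IsControllable A B) :
    ∃ G : Matrix (Fin n × Fin m) (Fin n) ℝ, ctrbMatrix A B * G = 1 := by
  have hsurj : Function.Surjective (ctrbMatrix A B).mulVec := by
    have : LinearMap.range (ctrbMatrix A B).mulVecLin = ⊤ := by
      refine Submodule.eq_top_of_finrank_eq ?_
      rw [Module.finrank_fin_fun]
      exact h
    exact LinearMap.range_eq_top.mp this
  exact Matrix.mulVec_surjective_iff_exists_right_inverse.mp hsurj

/-- For a controllable pair there is a control sequence that steers every initial state to `0` in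
`n` steps; the columns of `Z k` are the states at time `k`. -/
theorem IsControllable.exists_null_control (h : IsControllable A B) :
    ∃ (Z : ℕ → Matrix (Fin n) (Fin n) ℝ) (U : ℕ → Matrix (Fin m) (Fin n) ℝ),
      Z 0 = 1 ∧ (∀ k, Z (k + 1) = A * Z k + B * U k) ∧ Z n = 0 := by
  obtain ⟨G, hG⟩ := h.exists_ctrbMatrix_mul_eq_one
  -- The blocks of `-G Aⁿ`: since `F_u G = 1`, these inputs cancel the free response `Aⁿ` at time
  -- `n`.
  set V : Fin n → Matrix (Fin m) (Fin n) ℝ :=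
    fun j => Matrix.of fun i c => -((G * A ^ n) (j, i) c) with hV
  set U : ℕ → Matrix (Fin m) (Fin n) ℝ := fun j => if hj : j < n then V ⟨j, hj⟩ else 0 with hU
  refine ⟨fun k => A ^ k + ∑ j ∈ Finset.range k, A ^ (k - 1 - j) * B * U j, U, by simp,
    fun k => ?_, ?_⟩
  · simp only [Finset.sum_range_succ, Matrix.mul_add, Finset.mul_sum, Nat.add_sub_cancel,
      Nat.sub_self, pow_zero, Matrix.one_mul, ← pow_succ', ← add_assoc]
    congr 2
    refine Finset.sum_congr rfl fun j hj => ?_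
    have hj : j < k := Finset.mem_range.mp hj
    rw [← Matrix.mul_assoc, ← Matrix.mul_assoc, ← pow_succ',
      show k - 1 - j + 1 = k - j by omega]
  · have h1 : ∑ j ∈ Finset.range n, A ^ (n - 1 - j) * B * U j = ctrbMatrix A B * -(G * A ^ n) := by
      rw [Finset.sum_range]
      ext r c
      rw [Matrix.sum_apply, Matrix.mul_apply, Fintype.sum_prod_type]
      refine Finset.sum_congr rfl fun j _ => ?_
      rw [Matrix.mul_apply]
      simp [hU, hV, ctrbMatrix]
    simp only [h1]
    rw [Matrix.mul_neg, ← Matrix.mul_assoc, hG, Matrix.one_mul, add_neg_cancel]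

theorem IsObservable.eq_zero_of_forall (h : IsObservable A C) {x : Fin n → ℝ}
    (hx : ∀ i < n, C *ᵥ (A ^ i *ᵥ x) = 0) : x = 0 := by
  have hker : LinearMap.ker (obsvMatrix A C).mulVecLin = ⊥ := by
    have h1 := LinearMap.finrank_range_add_finrank_ker (obsvMatrix A C).mulVecLin
    have h2 : Module.finrank ℝ (LinearMap.range (obsvMatrix A C).mulVecLin) = n := h
    rw [Module.finrank_fin_fun, h2] at h1
    exact Submodule.finrank_eq_zero.mp (by omega)
  refine (LinearMap.ker_eq_bot'.mp hker) x ?_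
  ext ⟨i, r⟩
  have := congrFun (hx i i.isLt) r
  rw [Matrix.mulVec_mulVec] at this
  simpa [obsvMatrix, Matrix.mulVec, dotProduct] using this

end Structural

/-! ### The value iteration -/

section ValueIteration

variable {n m l : ℕ} {A : Matrix (Fin n) (Fin n) ℝ} {B : Matrix (Fin n) (Fin m) ℝ}
  {C : Matrix (Fin l) (Fin n) ℝ} {Q : Matrix (Fin l) (Fin l) ℝ} {R : Matrix (Fin m) (Fin m) ℝ}
  {P : Matrix (Fin n) (Fin n) ℝ}

/-- The `k`-th iterate of the Riccati map started at `CᵀQC`. -/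
noncomputable def riccatiIter (A : Matrix (Fin n) (Fin n) ℝ) (B : Matrix (Fin n) (Fin m) ℝ)
    (C : Matrix (Fin l) (Fin n) ℝ) (Q : Matrix (Fin l) (Fin l) ℝ) (R : Matrix (Fin m) (Fin m) ℝ)
    (k : ℕ) : Matrix (Fin n) (Fin n) ℝ :=
  (riccatiMap A B C Q R)^[k] (Cᵀ * Q * C)

theorem riccatiIter_succ (k : ℕ) :
    riccatiIter A B C Q R (k + 1) = riccatiMap A B C Q R (riccatiIter A B C Q R k) :=
  Function.iterate_succ_apply' _ _ _

theorem riccatiIter_nonneg (hQ : Q.PosSemidef) (hR : R.PosDef) (k : ℕ) :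
    0 ≤ riccatiIter A B C Q R k := by
  have h0 : 0 ≤ Cᵀ * Q * C := transpose_mul_mul_nonneg hQ.nonneg C
  induction k with
  | zero => exact h0
  | succ k ih => rw [riccatiIter_succ]; exact h0.trans (le_riccatiMap hR ih)

theorem riccatiIter_monotone (hQ : Q.PosSemidef) (hR : R.PosDef) :
    Monotone (riccatiIter A B C Q R) := by
  refine monotone_nat_of_le_succ fun k => ?_
  induction k with
  | zero => rw [riccatiIter_succ]; exact le_riccatiMap hR (riccatiIter_nonneg hQ hR 0)
  | succ k ih =>
    rw [riccatiIter_succ k, riccatiIter_succ (k + 1)]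
    exact riccatiMap_mono hR (riccatiIter_nonneg hQ hR k) ih

/-- The cost of a null control over `n` steps bounds `X_{k+n} ≥ X_k`. The terminal state is `0`, so
the bound does not depend on `k`. -/
theorem riccatiIter_bddAbove (hAB : IsControllable A B) (hQ : Q.PosSemidef) (hR : R.PosDef) :
    ∃ Y, ∀ k, riccatiIter A B C Q R k ≤ Y := by
  obtain ⟨Z, U, hZ0, hZ, hZn⟩ := hAB.exists_null_control
  have key : ∀ j k, riccatiIter A B C Q R (k + j) ≤ (Z j)ᵀ * riccatiIter A B C Q R k * Z j +
      ∑ i ∈ Finset.range j, ((U i)ᵀ * R * U i + (Z i)ᵀ * (Cᵀ * Q * C) * Z i) := by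
    intro j
    induction j with
    | zero => intro k; simp [hZ0]
    | succ j ih =>
      intro k
      have h1 := ih (k + 1)
      rw [riccatiIter_succ k] at h1
      rw [show k + (j + 1) = k + 1 + j by ring, Finset.sum_range_succ, add_comm (Finset.sum _ _),
        ← add_assoc, hZ]
      exact h1.trans (add_le_add_left
        (transpose_mul_riccatiMap_mul_le hR (riccatiIter_nonneg hQ hR k) (Z j) (U j)) _)
  refine ⟨∑ i ∈ Finset.range n, ((U i)ᵀ * R * U i + (Z i)ᵀ * (Cᵀ * Q * C) * Z i),
    fun k => ((riccatiIter_monotone hQ hR) (Nat.le_add_right k n)).trans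
    ((key n k).trans_eq ?_)⟩
  rw [hZn, Matrix.mul_zero, zero_add]

theorem closedLoop_mulVec_of_feedbackGain_mulVec_eq_zero {X : Matrix (Fin n) (Fin n) ℝ}
    {x : Fin n → ℝ} (h : feedbackGain A B R X *ᵥ x = 0) : closedLoop A B R X *ᵥ x = A *ᵥ x := by
  rw [closedLoop, Matrix.sub_mulVec, ← Matrix.mulVec_mulVec, h, Matrix.mulVec_zero, sub_zero]

/-- A zero optimal cost forces every stage cost to vanish. Then the input `K x` is zero, the closed
loop moves `x` to `A x`, and the remaining cost is again zero. -/
theorem output_eq_zero_of_riccatiIter (hQ : Q.PosSemidef) (hR : R.PosDef) (k : ℕ) :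
    ∀ x, x ⬝ᵥ riccatiIter A B C Q R k *ᵥ x = 0 → ∀ i ≤ k, (Q * C) *ᵥ (A ^ i *ᵥ x) = 0 := by
  induction k with
  | zero =>
    intro x hx i hi
    have hx' : x ⬝ᵥ ((0 : Matrix (Fin m) (Fin n) ℝ)ᵀ * R * (0 : Matrix (Fin m) (Fin n) ℝ) +
        Cᵀ * Q * C) *ᵥ x = 0 := by
      rw [Matrix.mul_zero, zero_add]
      exact hx
    simpa [Nat.le_zero.mp hi] using (mulVec_eq_zero_of_stageCost_eq_zero hQ hR hx').2
  | succ k ih =>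
    intro x hx i hi
    have hX := riccatiIter_nonneg (A := A) (B := B) (C := C) hQ hR k
    rw [riccatiIter_succ, riccatiMap_eq_closedLoop hR hX, Matrix.add_mulVec, dotProduct_add,
      dotProduct_transpose_mul_mul] at hx
    have h1 := (Matrix.nonneg_iff_posSemidef.mp hX).dotProduct_mulVec_nonneg
      (closedLoop A B R (riccatiIter A B C Q R k) *ᵥ x)
    have h2 := (Matrix.nonneg_iff_posSemidef.mp (stageCost_nonneg hQ hR
      (feedbackGain A B R (riccatiIter A B C Q R k)) C)).dotProduct_mulVec_nonneg x
    simp only [star_trivial] at h1 h2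
    obtain ⟨hK, hC⟩ := mulVec_eq_zero_of_stageCost_eq_zero hQ hR (x := x) (C := C)
      (K := feedbackGain A B R (riccatiIter A B C Q R k)) (by linarith)
    rw [closedLoop_mulVec_of_feedbackGain_mulVec_eq_zero hK] at h1 hx
    rcases i with _ | i
    · simpa using hC
    · have hpow : A ^ (i + 1) *ᵥ x = A ^ i *ᵥ (A *ᵥ x) := by rw [Matrix.mulVec_mulVec, pow_succ]
      rw [hpow]
      exact ih _ (by linarith) i (by omega)

theorem riccatiIter_posDef (hQ : Q.PosSemidef) (hR : R.PosDef) (hAQC : IsObservable A (Q * C)) :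
    (riccatiIter A B C Q R n).PosDef :=
  posDef_of_nonneg (riccatiIter_nonneg hQ hR n) fun x hx =>
    hAQC.eq_zero_of_forall fun i hi => output_eq_zero_of_riccatiIter hQ hR n x hx i hi.le

/-- The closed loop of a positive definite solution of the Riccati equation is exponentially
stable. -/
theorem IsPosDefDARESolution.exists_norm_closedLoop_pow_le (hQ : Q.PosSemidef) (hR : R.PosDef)
    (hAQC : IsObservable A (Q * C)) (hP : IsPosDefDARESolution A B C Q R P) :
    ∃ c μ : ℝ, 0 < c ∧ 0 < μ ∧ μ < 1 ∧ ∀ k : ℕ, ‖closedLoop A B R P ^ k‖ ≤ c * μ ^ k := by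
  have hP0 : 0 ≤ P := hP.1.posSemidef.nonneg
  set F := closedLoop A B R P with hF
  set K := feedbackGain A B R P with hK
  have hV : P - Fᵀ * P * F = Kᵀ * R * K + Cᵀ * Q * C := by
    have := hP.2
    rw [riccatiMap_eq_closedLoop hR hP0] at this
    exact sub_eq_of_eq_add' this
  have hV0 := stageCost_nonneg hQ hR K C
  -- `P` itself only gives the semidefinite decrease `KᵀRK + CᵀQC`. Summing over powers of `F`
  -- collects this stage cost along a trajectory, where observability makes it definite.
  refine exists_norm_pow_le_of_lyapunov (S := ∑ j ∈ Finset.range (n + 1), (F ^ j)ᵀ * P * F ^ j)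
    ?_ ?_
  · refine posDef_of_le hP.1 ?_
    rw [Finset.sum_range_succ', pow_zero, Matrix.transpose_one, Matrix.one_mul, Matrix.mul_one]
    exact le_add_of_nonneg_left <|
      Finset.sum_nonneg fun j _ => transpose_mul_mul_nonneg hP0 (F ^ (j + 1))
  · have hS : (∑ j ∈ Finset.range (n + 1), (F ^ j)ᵀ * P * F ^ j) -
        Fᵀ * (∑ j ∈ Finset.range (n + 1), (F ^ j)ᵀ * P * F ^ j) * F =
        ∑ j ∈ Finset.range (n + 1), (F ^ j)ᵀ * (Kᵀ * R * K + Cᵀ * Q * C) * F ^ j := by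
      rw [Finset.mul_sum, Finset.sum_mul, ← Finset.sum_sub_distrib]
      refine Finset.sum_congr rfl fun j _ => ?_
      have hc : F * F ^ j = F ^ j * F := (pow_succ' F j).symm.trans (pow_succ F j)
      have hct : Fᵀ * (F ^ j)ᵀ = (F ^ j)ᵀ * Fᵀ := by
        rw [← Matrix.transpose_mul, ← Matrix.transpose_mul, hc]
      rw [← hV, Matrix.mul_sub, Matrix.sub_mul, sub_right_inj]
      calc Fᵀ * ((F ^ j)ᵀ * P * F ^ j) * F = Fᵀ * (F ^ j)ᵀ * P * (F ^ j * F) := by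
            simp only [Matrix.mul_assoc]
        _ = (F ^ j)ᵀ * (Fᵀ * P * F) * F ^ j := by
            rw [hct, ← hc]; simp only [Matrix.mul_assoc]
    rw [hS]
    have hterm : ∀ j, 0 ≤ (F ^ j)ᵀ * (Kᵀ * R * K + Cᵀ * Q * C) * F ^ j := fun j =>
      transpose_mul_mul_nonneg hV0 _
    refine posDef_of_nonneg (Finset.sum_nonneg fun j _ => hterm j) fun x hx => ?_
    have hzero : ∀ j < n + 1, K *ᵥ (F ^ j *ᵥ x) = 0 ∧ (Q * C) *ᵥ (F ^ j *ᵥ x) = 0 := by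
      intro j hj
      refine mulVec_eq_zero_of_stageCost_eq_zero hQ hR ?_
      rw [← dotProduct_transpose_mul_mul]
      have h1 := dotProduct_mulVec_mono
        (Finset.single_le_sum (fun i _ => hterm i) (Finset.mem_range.mpr hj)) x
      have h2 := (Matrix.nonneg_iff_posSemidef.mp (hterm j)).dotProduct_mulVec_nonneg x
      simp only [star_trivial] at h2
      exact le_antisymm (h1.trans hx.le) h2
    -- Where the feedback vanishes, the closed-loop and open-loop trajectories agree, so
    -- observability of the open loop applies.
    have hpow : ∀ j ≤ n, F ^ j *ᵥ x = A ^ j *ᵥ x := by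
      intro j
      induction j with
      | zero => simp
      | succ j ih =>
        intro hj
        rw [pow_succ', pow_succ', ← Matrix.mulVec_mulVec, ← Matrix.mulVec_mulVec,
          ← ih (by omega)]
        exact closedLoop_mulVec_of_feedbackGain_mulVec_eq_zero (hzero j (by omega)).1
    refine hAQC.eq_zero_of_forall fun i hi => ?_
    rw [← hpow i hi.le]
    exact (hzero i (by omega)).2

end ValueIteration

/-! ### Existence, uniqueness and exponential convergence -/

section Convergence

variable {n m l : ℕ} {A : Matrix (Fin n) (Fin n) ℝ} {B : Matrix (Fin n) (Fin m) ℝ}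
  {C : Matrix (Fin l) (Fin n) ℝ} {Q : Matrix (Fin l) (Fin l) ℝ} {R : Matrix (Fin m) (Fin m) ℝ}
  {P P' : Matrix (Fin n) (Fin n) ℝ}

/-- The limit of the iterates is a fixed point by continuity of the Riccati map, and is definite
because it dominates `X_n`. The upper bound is kept for the convergence rate. -/
theorem exists_isPosDefDARESolution (hAB : IsControllable A B) (hQ : Q.PosSemidef)
    (hR : R.PosDef) (hAQC : IsObservable A (Q * C)) :
    ∃ P, IsPosDefDARESolution A B C Q R P ∧ ∀ k, riccatiIter A B C Q R k ≤ P := by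
  obtain ⟨Y, hY⟩ := riccatiIter_bddAbove (C := C) hAB hQ hR
  obtain ⟨P, hlim, hle⟩ := exists_tendsto_of_monotone
    (fun k => transpose_eq_of_nonneg (riccatiIter_nonneg hQ hR k)) (riccatiIter_monotone hQ hR) hY
  have hP0 : 0 ≤ P := (riccatiIter_nonneg hQ hR 0).trans (hle 0)
  refine ⟨P, ⟨posDef_of_le (riccatiIter_posDef hQ hR hAQC) (hle n), ?_⟩, hle⟩
  refine tendsto_nhds_unique ((tendsto_add_atTop_iff_nat 1).mpr hlim) ?_
  exact ((continuousAt_riccatiMap hR hP0).tendsto.comp hlim).congr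
    fun k => (riccatiIter_succ k).symm

theorem l2_opNorm_transpose {p : Type*} [Fintype p] [DecidableEq p] (M : Matrix p p ℝ) :
    ‖Mᵀ‖ = ‖M‖ := by
  rw [← Matrix.conjTranspose_eq_transpose_of_trivial, Matrix.l2_opNorm_conjTranspose]

theorem IsPosDefDARESolution.sub_eq (hR : R.PosDef) (hP : IsPosDefDARESolution A B C Q R P)
    (hP' : IsPosDefDARESolution A B C Q R P') (k : ℕ) :
    P - P' = (closedLoop A B R P ^ k)ᵀ * (P - P') * closedLoop A B R P' ^ k := by
  induction k with
  | zero => simp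
  | succ k ih =>
    have h : P - P' = (closedLoop A B R P)ᵀ * (P - P') * closedLoop A B R P' := by
      rw [← riccatiMap_sub_riccatiMap (C := C) (Q := Q) hR hP'.1.posSemidef.nonneg
        hP.1.posSemidef.nonneg, ← hP.2, ← hP'.2]
    nth_rewrite 1 [h]
    nth_rewrite 1 [ih]
    rw [pow_succ, pow_succ, Matrix.transpose_mul]
    simp only [Matrix.mul_assoc]

theorem IsPosDefDARESolution.unique (hQ : Q.PosSemidef) (hR : R.PosDef)
    (hAQC : IsObservable A (Q * C)) (hP : IsPosDefDARESolution A B C Q R P)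
    (hP' : IsPosDefDARESolution A B C Q R P') : P = P' := by
  obtain ⟨c, μ, hc, hμ0, hμ1, hcμ⟩ := hP.exists_norm_closedLoop_pow_le hQ hR hAQC
  obtain ⟨c', μ', hc', hμ0', hμ1', hcμ'⟩ := hP'.exists_norm_closedLoop_pow_le hQ hR hAQC
  have hbound : ∀ k : ℕ, ‖P - P'‖ ≤ c * ‖P - P'‖ * c' * (μ * μ') ^ k := by
    intro k
    calc ‖P - P'‖ = ‖(closedLoop A B R P ^ k)ᵀ * (P - P') * closedLoop A B R P' ^ k‖ := by
          rw [← hP.sub_eq hR hP' k]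
      _ ≤ ‖(closedLoop A B R P ^ k)ᵀ‖ * ‖P - P'‖ * ‖closedLoop A B R P' ^ k‖ :=
          (Matrix.l2_opNorm_mul _ _).trans
            (mul_le_mul_of_nonneg_right (Matrix.l2_opNorm_mul _ _) (norm_nonneg _))
      _ ≤ (c * μ ^ k) * ‖P - P'‖ * (c' * μ' ^ k) := by
          rw [l2_opNorm_transpose]
          gcongr
          · exact hcμ k
          · exact hcμ' k
      _ = c * ‖P - P'‖ * c' * (μ * μ') ^ k := by rw [mul_pow]; ring
  have hlim : Tendsto (fun k : ℕ => c * ‖P - P'‖ * c' * (μ * μ') ^ k) atTop (𝓝 0) := by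
    simpa using (tendsto_pow_atTop_nhds_zero_of_lt_one (by positivity)
      (mul_lt_one_of_nonneg_of_lt_one_left hμ0.le hμ1 hμ1'.le)).const_mul (c * ‖P - P'‖ * c')
  exact sub_eq_zero.mp (norm_le_zero_iff.mp (ge_of_tendsto' hlim hbound))

/-- The products of the closed-loop matrices along the value iteration, starting at step `N`. -/
noncomputable def transition (A : Matrix (Fin n) (Fin n) ℝ) (B : Matrix (Fin n) (Fin m) ℝ)
    (C : Matrix (Fin l) (Fin n) ℝ) (Q : Matrix (Fin l) (Fin l) ℝ) (R : Matrix (Fin m) (Fin m) ℝ)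
    (N : ℕ) : ℕ → Matrix (Fin n) (Fin n) ℝ
  | 0 => 1
  | k + 1 => transition A B C Q R N k * closedLoop A B R (riccatiIter A B C Q R (N + k))

/-- Telescoping `F_Xᵀ X F_X ≤ ℛ(X)`. For definite `X_N` this bounds the transition matrices
uniformly in `k`, with no stability of the individual factors. -/
theorem transition_transpose_mul_mul_le (hQ : Q.PosSemidef) (hR : R.PosDef) (N k : ℕ) :
    (transition A B C Q R N k)ᵀ * riccatiIter A B C Q R N * transition A B C Q R N k ≤
      riccatiIter A B C Q R (N + k) := by
  induction k with
  | zero => simp [transition]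
  | succ k ih =>
    have h := (transpose_mul_mul_mono ih (closedLoop A B R (riccatiIter A B C Q R (N + k)))).trans
      (closedLoop_mul_mul_le_riccatiMap (C := C) hQ hR (riccatiIter_nonneg hQ hR (N + k)))
    rw [← riccatiIter_succ] at h
    rw [← Nat.add_assoc]
    simpa only [transition, Matrix.transpose_mul, Matrix.mul_assoc] using h

/-- The form occurring in the difference of gains: the extra closed-loop factor becomes the last
factor of the transition. -/
theorem sub_riccatiIter_mul_closedLoop_eq (hQ : Q.PosSemidef) (hR : R.PosDef)
    (hP : IsPosDefDARESolution A B C Q R P) (N k : ℕ) :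
    (P - riccatiIter A B C Q R (N + k)) * closedLoop A B R (riccatiIter A B C Q R (N + k)) =
      (closedLoop A B R P ^ k)ᵀ * (P - riccatiIter A B C Q R N) *
        transition A B C Q R N (k + 1) := by
  have key : P - riccatiIter A B C Q R (N + k) =
      (closedLoop A B R P ^ k)ᵀ * (P - riccatiIter A B C Q R N) * transition A B C Q R N k := by
    induction k with
    | zero => simp [transition]
    | succ k ih =>
      have h := riccatiMap_sub_riccatiMap (A := A) (B := B) (C := C) (Q := Q) hR
        (riccatiIter_nonneg (A := A) (B := B) (C := C) hQ hR (N + k)) hP.1.posSemidef.nonneg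
      rw [← hP.2, ← riccatiIter_succ, ih] at h
      rw [← Nat.add_assoc, h, pow_succ, Matrix.transpose_mul, transition]
      simp only [Matrix.mul_assoc]
  rw [key, transition]
  simp only [Matrix.mul_assoc]

/-- The finitely many values before `N` are absorbed into the constant. -/
theorem exists_le_mul_pow_of_shift {f : ℕ → ℝ} {c μ : ℝ} (hμ : 0 < μ) (N : ℕ)
    (h : ∀ k, f (N + k) ≤ c * μ ^ k) : ∃ c' : ℝ, 0 < c' ∧ ∀ k, f k ≤ c' * μ ^ k := by
  have hsum : 0 ≤ ∑ i ∈ Finset.range N, |f i| / μ ^ i :=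
    Finset.sum_nonneg fun i _ => by positivity
  refine ⟨|c| / μ ^ N + ∑ i ∈ Finset.range N, |f i| / μ ^ i + 1, by positivity, fun k => ?_⟩
  rcases lt_or_ge k N with hk | hk
  · have h1 : |f k| / μ ^ k ≤ ∑ i ∈ Finset.range N, |f i| / μ ^ i :=
      Finset.single_le_sum (f := fun i => |f i| / μ ^ i) (fun i _ => by positivity)
        (Finset.mem_range.mpr hk)
    have h2 : 0 ≤ |c| / μ ^ N := by positivity
    calc f k ≤ |f k| / μ ^ k * μ ^ k := by
          rw [div_mul_cancel₀ _ (by positivity)]; exact le_abs_self _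
      _ ≤ _ := by gcongr; linarith
  · obtain ⟨j, rfl⟩ := Nat.exists_eq_add_of_le hk
    calc f (N + j) ≤ |c| * μ ^ j := (h j).trans (by gcongr; exact le_abs_self c)
      _ = |c| / μ ^ N * μ ^ (N + j) := by rw [pow_add]; field_simp
      _ ≤ _ := by gcongr; linarith

/-- The gains of the value iteration converge exponentially to the stationary gain. -/
theorem exists_norm_feedbackGain_sub_le (hQ : Q.PosSemidef) (hR : R.PosDef)
    (hAQC : IsObservable A (Q * C)) (hP : IsPosDefDARESolution A B C Q R P)
    (hle : ∀ k, riccatiIter A B C Q R k ≤ P) :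
    ∃ c μ : ℝ, 0 < c ∧ 0 < μ ∧ μ < 1 ∧ ∀ k : ℕ,
      ‖feedbackGain A B R (riccatiIter A B C Q R k) - feedbackGain A B R P‖ ≤ c * μ ^ k := by
  have hP0 : 0 ≤ P := hP.1.posSemidef.nonneg
  obtain ⟨c, μ, hc, hμ0, hμ1, hcμ⟩ := hP.exists_norm_closedLoop_pow_le hQ hR hAQC
  obtain ⟨d, hd, hdΦ⟩ := exists_norm_le_of_transpose_mul_mul_le
    (riccatiIter_posDef (B := B) hQ hR hAQC) (transpose_eq_of_nonneg hP0)
  have hΦ : ∀ k, ‖transition A B C Q R n k‖ ≤ d := fun k => by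
    simpa using hdΦ _ 1 zero_le_one (by
      simpa using (transition_transpose_mul_mul_le hQ hR n k).trans (hle (n + k)))
  have hshift : ∀ k, ‖feedbackGain A B R (riccatiIter A B C Q R (n + k)) - feedbackGain A B R P‖ ≤
      ‖(R + Bᵀ * P * B)⁻¹ * Bᵀ‖ * (c * ‖P - riccatiIter A B C Q R n‖ * d) * μ ^ k := by
    intro k
    -- Reversing the difference puts `P` in the role of `Y`, so the inverse does not vary with `k`.
    rw [norm_sub_rev, feedbackGain_sub_feedbackGain hR (riccatiIter_nonneg hQ hR _) hP0,
      sub_riccatiIter_mul_closedLoop_eq hQ hR hP]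
    calc _ ≤ ‖(R + Bᵀ * P * B)⁻¹ * Bᵀ‖ * (‖(closedLoop A B R P ^ k)ᵀ‖ *
          ‖P - riccatiIter A B C Q R n‖ * ‖transition A B C Q R n (k + 1)‖) :=
          (Matrix.l2_opNorm_mul _ _).trans <| mul_le_mul_of_nonneg_left
            ((Matrix.l2_opNorm_mul _ _).trans
              (mul_le_mul_of_nonneg_right (Matrix.l2_opNorm_mul _ _) (norm_nonneg _)))
            (norm_nonneg _)
      _ ≤ ‖(R + Bᵀ * P * B)⁻¹ * Bᵀ‖ * (c * μ ^ k * ‖P - riccatiIter A B C Q R n‖ * d) := by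
          rw [l2_opNorm_transpose]
          gcongr
          · exact hcμ k
          · exact hΦ (k + 1)
      _ = _ := by ring
  obtain ⟨c', hc', h⟩ := exists_le_mul_pow_of_shift
    (f := fun k => ‖feedbackGain A B R (riccatiIter A B C Q R k) - feedbackGain A B R P‖)
    hμ0 n hshift
  exact ⟨c', μ, hc', hμ0, hμ1, h⟩

end Convergence

end LQR

/-- `‖·‖` is the spectral norm (the operator norm induced by the Euclidean norms). -/
theorem mainTheorem3 {n m l : ℕ}
    (A : Matrix (Fin n) (Fin n) ℝ) (B : Matrix (Fin n) (Fin m) ℝ) (C : Matrix (Fin l) (Fin n) ℝ)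
    (Q : Matrix (Fin l) (Fin l) ℝ) (R : Matrix (Fin m) (Fin m) ℝ)
    (hAB : LQR.IsControllable A B) (hAC : LQR.IsObservable A C)
    (hQ : Q.PosSemidef) (hR : R.PosDef) (hAQC : LQR.IsObservable A (Q * C)) :
    ∃ Pstar : Matrix (Fin n) (Fin n) ℝ,
      LQR.IsPosDefDARESolution A B C Q R Pstar ∧
      (∀ P : Matrix (Fin n) (Fin n) ℝ, LQR.IsPosDefDARESolution A B C Q R P → P = Pstar) ∧
      ∃ c₁ c₂ μ : ℝ, 0 < c₁ ∧ 0 < c₂ ∧ 0 < μ ∧ μ < 1 ∧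
        ∀ T t : ℕ, 1 ≤ t → t ≤ T →
          ‖LQR.gainLQR A B C Q R T (T - t) - LQR.gainLQRStar A B C R Pstar‖ ≤ c₁ * c₂ * μ ^ t := by
  obtain ⟨P, hP, hle⟩ := LQR.exists_isPosDefDARESolution hAB hQ hR hAQC
  refine ⟨P, hP, fun P' hP' => hP'.unique hQ hR hAQC hP, ?_⟩
  obtain ⟨c, μ, hc, hμ0, hμ1, h⟩ := LQR.exists_norm_feedbackGain_sub_le hQ hR hAQC hP hle
  -- The gain at time `T - t` uses `P_{T-t+1} = X_{t-1}`; dividing by `μ` pays for the lost step.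
  -- The `+ 1` makes `c₂` positive even if the window matrix is zero.
  refine ⟨c / μ, ‖LQR.windowMatrix A B C‖ + 1, μ, by positivity, by positivity, hμ0, hμ1,
    fun T t ht htT => ?_⟩
  obtain ⟨k, rfl⟩ := Nat.exists_eq_add_of_le' ht
  have hiter : LQR.riccatiP A B C Q R T (T - (k + 1) + 1) = LQR.riccatiIter A B C Q R k := by
    rw [LQR.riccatiP, LQR.riccatiIter, show T - (T - (k + 1) + 1) = k by omega]
  rw [LQR.gainLQR, LQR.gainLQRStar, hiter, ← Matrix.sub_mul]
  calc _ ≤ ‖LQR.feedbackGain A B R (LQR.riccatiIter A B C Q R k) - LQR.feedbackGain A B R P‖ *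
        ‖LQR.windowMatrix A B C‖ := Matrix.l2_opNorm_mul _ _
    _ ≤ (c * μ ^ k) * (‖LQR.windowMatrix A B C‖ + 1) := by
        gcongr
        · exact h k
        · linarith
    _ = c / μ * (‖LQR.windowMatrix A B C‖ + 1) * μ ^ (k + 1) := by
        rw [pow_succ]; field_simp
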